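/- Let $R$ be a finite field of characteristic $p$ and order $p^n$, and let $\mathcal{B}$ be the category of commutative unital $R$-algebras. A co-$\mathcal{B}$-object is an $R$-algebra $A$ with co-operations dual to the operations of a commutative $R$-algebra: $\Delta^+,\Delta^\times\colon A\to A\otimes_R A$, a co-inverse $A\to A$, and $\epsilon_r\colon A\to R$ for each $r\in R$, satisfying the duals of the identities of commutative $R$-algebras. Equivalently, each set $\mathrm{Hom}_{\mathcal B}(A,B)$ is naturally a commutative $R$-algebra, so $A$ represents a functor $\mathcal{B}\to\mathcal{B}$. The Tall–Wraith product $\odot$ of co-$\mathcal{B}$-objects is the monoidal product that corresponds to composition of the represented functors. A Tall–Wraith monoid is a monoid for $\odot$; equivalently, it is a co-$\mathcal{B}$-object with a comonad structure on the functor that it represents. A morphism of Tall–Wraith monoids is an $R$-algebra homomorphism that respects the co-operations, units and multiplications. The polynomial algebra $R[x]$ is a Tall–Wraith monoid with $\Delta^+x=x\otimes 1+1\otimes x$, $\Delta^\times x=x\otimes x$, co-inverse $x\mapsto -x$, $\epsilon_r(f)=f(r)$, multiplication given by composition of polynomials, and unit $x$. The algebra $R^R=\mathrm{Hom}_{\mathrm{Set}}(|R|,|R|)$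 of all functions $R\to R$ is a Tall–Wraith monoid: its co-operations are obtained by pulling back along the operations of $R$ and using the isomorphism $R^R\otimes_R R^R\cong R^{R\times R}$, with $\epsilon_r(f)=f(r)$; its multiplication is given by composition of functions, and its unit is the identity function. Let $I=(x^{p^n}-x)\subseteq R[x]$. Then: 1. $I$ is a co-ideal: for $f\in I$, both $\Delta^+f$ and $\Delta^\times f$ lie in the ideal $I\otimes R[x]+R[x]\otimes I$ of $R[x]\otimes_R R[x]$, the co-inverse maps $f$ into $I$, and $\epsilon_r(f)=0$ for all $r\in R$. 2. $I$ is compatible with composition: $f\circ g-f\circ 0\in I$ for all $f\in R[x]$, $g\in I$, and $f\circ g\in I$ for all $f\in I$, $g\in R[x]$. 3. There is a unique Tall–Wraith monoid structure on $R[x]/I$ for which the projection $R[x]\to R[x]/I$ is a morphism of Tall–Wraith monoids, and for this structure there is an isomorphism of Tall–Wraith monoids $$\eta_R\colon R[x]/(x^{p^n}-x)\longrightarrow \mathrm{Hom}_{\mathrm{Set}}(|R|,|R|)$$ that sends the class of $x$ to the identity map of $|R|$. -/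

import Mathlib

open scoped TensorProduct Polynomial
open CategoryTheory

universe u

namespace TallWraith

section CoObjects

variable (R : Type u) [CommRing R] (A : Type u) [CommRing A] [Algebra R A]

/-- The structure of a co-(commutative `R`-algebra) object on an object `A` of the category of
commutative unital `R`-algebras.  The coproduct in that category is `⊗[R]` and the initial object
is `R`, so each operation of the theory of commutative `R`-algebras (addition, multiplication,
negation, and one constant for each `r : R`) gives a co-operation, and each identity of the theory
gives a commutative diagram. -/
@[ext]
structure CoAlgObj where
  /-- co-addition -/
  coadd : A →ₐ[R] A ⊗[R] A
  /-- co-multiplication -/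
  comul : A →ₐ[R] A ⊗[R] A
  /-- co-inverse for the co-addition -/
  coneg : A →ₐ[R] A
  /-- the co-operation of the constant `r` -/
  coconst : R → (A →ₐ[R] R)
  coadd_coassoc :
    (Algebra.TensorProduct.assoc R R R A A A).toAlgHom.comp
      ((Algebra.TensorProduct.map coadd (AlgHom.id R A)).comp coadd) =
    (Algebra.TensorProduct.map (AlgHom.id R A) coadd).comp coadd
  coadd_cocomm : (Algebra.TensorProduct.comm R A A).toAlgHom.comp coadd = coadd
  coadd_counit :
    (Algebra.TensorProduct.lid R A).toAlgHom.comp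
      ((Algebra.TensorProduct.map (coconst 0) (AlgHom.id R A)).comp coadd) = AlgHom.id R A
  coadd_coneg :
    (Algebra.TensorProduct.lmul' R).comp
      ((Algebra.TensorProduct.map coneg (AlgHom.id R A)).comp coadd) =
    (Algebra.ofId R A).comp (coconst 0)
  comul_coassoc :
    (Algebra.TensorProduct.assoc R R R A A A).toAlgHom.comp
      ((Algebra.TensorProduct.map comul (AlgHom.id R A)).comp comul) =
    (Algebra.TensorProduct.map (AlgHom.id R A) comul).comp comul
  comul_cocomm : (Algebra.TensorProduct.comm R A A).toAlgHom.comp comul = comul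
  comul_counit :
    (Algebra.TensorProduct.lid R A).toAlgHom.comp
      ((Algebra.TensorProduct.map (coconst 1) (AlgHom.id R A)).comp comul) = AlgHom.id R A
  /-- dual of `a * (b + c) = a * b + a * c` -/
  codistrib :
    (Algebra.TensorProduct.map (AlgHom.id R A) coadd).comp comul =
    ((Algebra.TensorProduct.map (Algebra.TensorProduct.lmul' R) (AlgHom.id R (A ⊗[R] A))).comp
      (Algebra.TensorProduct.tensorTensorTensorComm R R R R A A A A).toAlgHom).comp
      ((Algebra.TensorProduct.map comul comul).comp coadd)
  coconst_add : ∀ r s : R, coconst (r + s) =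
    (Algebra.TensorProduct.lmul' R).comp
      ((Algebra.TensorProduct.map (coconst r) (coconst s)).comp coadd)
  coconst_mul : ∀ r s : R, coconst (r * s) =
    (Algebra.TensorProduct.lmul' R).comp
      ((Algebra.TensorProduct.map (coconst r) (coconst s)).comp comul)

variable {R A}

namespace CoAlgObj

variable (c : CoAlgObj R A)

/-- The set of `R`-algebra homomorphisms `A → B`, as carrier of the `R`-algebra structure
that is induced by the co-operations of `A`. -/
def Points (_c : CoAlgObj R A) (B : Type u) [CommRing B] [Algebra R B] : Type u := A →ₐ[R] B

variable {B : Type u} [CommRing B] [Algebra R B]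

/-- An element of `c.Points B` as an algebra homomorphism. -/
def Points.hom {c : CoAlgObj R A} (f : c.Points B) : A →ₐ[R] B := f

/-- An algebra homomorphism as an element of `c.Points B`. -/
def point (f : A →ₐ[R] B) : c.Points B := f

@[simp] theorem hom_point (f : A →ₐ[R] B) : (c.point f).hom = f := rfl

@[simp] theorem point_hom (f : c.Points B) : c.point f.hom = f := rfl

variable {c} in
theorem Points.ext {f g : c.Points B} (h : ∀ a, f.hom a = g.hom a) : f = g :=
  AlgHom.ext h

instance : Add (c.Points B) :=
  ⟨fun f g => c.point ((Algebra.TensorProduct.productMap f.hom g.hom).comp c.coadd)⟩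

instance : Mul (c.Points B) :=
  ⟨fun f g => c.point ((Algebra.TensorProduct.productMap f.hom g.hom).comp c.comul)⟩

instance : Neg (c.Points B) := ⟨fun f => c.point (f.hom.comp c.coneg)⟩

/-- The point that is named by the constant `r`. -/
def constPoint (B : Type u) [CommRing B] [Algebra R B] (r : R) : c.Points B :=
  c.point ((Algebra.ofId R B).comp (c.coconst r))

instance : Zero (c.Points B) := ⟨c.constPoint B 0⟩

instance : One (c.Points B) := ⟨c.constPoint B 1⟩

theorem add_hom (f g : c.Points B) : (f + g).hom =
    (Algebra.TensorProduct.productMap f.hom g.hom).comp c.coadd := rfl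

theorem mul_hom (f g : c.Points B) : (f * g).hom =
    (Algebra.TensorProduct.productMap f.hom g.hom).comp c.comul := rfl

theorem neg_hom (f : c.Points B) : (-f).hom = f.hom.comp c.coneg := rfl

theorem constPoint_hom (r : R) :
    (c.constPoint B r).hom = (Algebra.ofId R B).comp (c.coconst r) := rfl

theorem zero_hom : (0 : c.Points B).hom = (Algebra.ofId R B).comp (c.coconst 0) := rfl

theorem one_hom : (1 : c.Points B).hom = (Algebra.ofId R B).comp (c.coconst 1) := rfl

theorem conv_assoc_aux (D : A →ₐ[R] A ⊗[R] A)
    (hD : (Algebra.TensorProduct.assoc R R R A A A).toAlgHom.comp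
      ((Algebra.TensorProduct.map D (AlgHom.id R A)).comp D) =
      (Algebra.TensorProduct.map (AlgHom.id R A) D).comp D) (f g h : A →ₐ[R] B) :
    (Algebra.TensorProduct.productMap
      ((Algebra.TensorProduct.productMap f g).comp D) h).comp D =
    (Algebra.TensorProduct.productMap f
      ((Algebra.TensorProduct.productMap g h).comp D)).comp D := by
  have h1 : Algebra.TensorProduct.productMap ((Algebra.TensorProduct.productMap f g).comp D) h =
      ((Algebra.TensorProduct.productMap f (Algebra.TensorProduct.productMap g h)).comp
        (Algebra.TensorProduct.assoc R R R A A A).toAlgHom).comp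
        (Algebra.TensorProduct.map D (AlgHom.id R A)) := by
    have key : (Algebra.TensorProduct.productMap (Algebra.TensorProduct.productMap f g) h) =
      (Algebra.TensorProduct.productMap f (Algebra.TensorProduct.productMap g h)).comp
        (Algebra.TensorProduct.assoc R R R A A A).toAlgHom := by
      ext <;> simp [Algebra.TensorProduct.one_def]
    rw [← key]
    ext <;> simp
  have h2 : Algebra.TensorProduct.productMap f ((Algebra.TensorProduct.productMap g h).comp D) =
      (Algebra.TensorProduct.productMap f (Algebra.TensorProduct.productMap g h)).comp
        (Algebra.TensorProduct.map (AlgHom.id R A) D) := by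
    ext <;> simp
  rw [h1, h2, AlgHom.comp_assoc, AlgHom.comp_assoc, hD, AlgHom.comp_assoc]

theorem conv_comm_aux (D : A →ₐ[R] A ⊗[R] A)
    (hD : (Algebra.TensorProduct.comm R A A).toAlgHom.comp D = D) (f g : A →ₐ[R] B) :
    (Algebra.TensorProduct.productMap f g).comp D =
    (Algebra.TensorProduct.productMap g f).comp D := by
  have h1 : Algebra.TensorProduct.productMap f g =
      (Algebra.TensorProduct.productMap g f).comp
        (Algebra.TensorProduct.comm R A A).toAlgHom := by
    ext <;> simp
  rw [h1, AlgHom.comp_assoc, hD]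

theorem conv_unit_aux (D : A →ₐ[R] A ⊗[R] A) (e : A →ₐ[R] R)
    (hD : (Algebra.TensorProduct.lid R A).toAlgHom.comp
      ((Algebra.TensorProduct.map e (AlgHom.id R A)).comp D) = AlgHom.id R A) (f : A →ₐ[R] B) :
    (Algebra.TensorProduct.productMap ((Algebra.ofId R B).comp e) f).comp D = f := by
  have h1 : Algebra.TensorProduct.productMap ((Algebra.ofId R B).comp e) f =
      (f.comp (Algebra.TensorProduct.lid R A).toAlgHom).comp
        (Algebra.TensorProduct.map e (AlgHom.id R A)) := by
    ext <;> simp [Algebra.ofId_apply, Algebra.algebraMap_eq_smul_one]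
  rw [h1, AlgHom.comp_assoc, AlgHom.comp_assoc, hD, AlgHom.comp_id]

theorem conv_comp_aux (D : A →ₐ[R] A ⊗[R] A) {C : Type u} [CommRing C] [Algebra R C]
    (k : B →ₐ[R] C) (f g : A →ₐ[R] B) :
    k.comp ((Algebra.TensorProduct.productMap f g).comp D) =
    (Algebra.TensorProduct.productMap (k.comp f) (k.comp g)).comp D := by
  have h1 : Algebra.TensorProduct.productMap (k.comp f) (k.comp g) =
      k.comp (Algebra.TensorProduct.productMap f g) := by
    ext <;> simp
  rw [h1, AlgHom.comp_assoc]

theorem points_add_assoc (f g h : c.Points B) : f + g + h = f + (g + h) :=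
  conv_assoc_aux c.coadd c.coadd_coassoc f.hom g.hom h.hom

theorem points_add_comm (f g : c.Points B) : f + g = g + f :=
  conv_comm_aux c.coadd c.coadd_cocomm f.hom g.hom

theorem points_zero_add (f : c.Points B) : 0 + f = f :=
  conv_unit_aux c.coadd (c.coconst 0) c.coadd_counit f.hom

theorem points_neg_add_cancel (f : c.Points B) : -f + f = 0 := by
  have h1 : Algebra.TensorProduct.productMap (f.hom.comp c.coneg) f.hom =
      (f.hom.comp (Algebra.TensorProduct.lmul' R)).comp
        (Algebra.TensorProduct.map c.coneg (AlgHom.id R A)) := by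
    ext <;> simp
  change (Algebra.TensorProduct.productMap (f.hom.comp c.coneg) f.hom).comp c.coadd =
    (Algebra.ofId R B).comp (c.coconst 0)
  rw [h1, AlgHom.comp_assoc, AlgHom.comp_assoc, c.coadd_coneg]
  ext a
  simp [Algebra.ofId_apply]

theorem points_mul_assoc (f g h : c.Points B) : f * g * h = f * (g * h) :=
  conv_assoc_aux c.comul c.comul_coassoc f.hom g.hom h.hom

theorem points_mul_comm (f g : c.Points B) : f * g = g * f :=
  conv_comm_aux c.comul c.comul_cocomm f.hom g.hom

theorem points_one_mul (f : c.Points B) : 1 * f = f :=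
  conv_unit_aux c.comul (c.coconst 1) c.comul_counit f.hom

theorem points_left_distrib (f g h : c.Points B) : f * (g + h) = f * g + f * h := by
  change (Algebra.TensorProduct.productMap f.hom
      ((Algebra.TensorProduct.productMap g.hom h.hom).comp c.coadd)).comp c.comul =
    (Algebra.TensorProduct.productMap
      ((Algebra.TensorProduct.productMap f.hom g.hom).comp c.comul)
      ((Algebra.TensorProduct.productMap f.hom h.hom).comp c.comul)).comp c.coadd
  have h1 : Algebra.TensorProduct.productMap f.hom
      ((Algebra.TensorProduct.productMap g.hom h.hom).comp c.coadd) =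
      (Algebra.TensorProduct.productMap f.hom
        (Algebra.TensorProduct.productMap g.hom h.hom)).comp
        (Algebra.TensorProduct.map (AlgHom.id R A) c.coadd) := by
    ext <;> simp
  have h2 : Algebra.TensorProduct.productMap
      ((Algebra.TensorProduct.productMap f.hom g.hom).comp c.comul)
      ((Algebra.TensorProduct.productMap f.hom h.hom).comp c.comul) =
      (Algebra.TensorProduct.productMap (Algebra.TensorProduct.productMap f.hom g.hom)
        (Algebra.TensorProduct.productMap f.hom h.hom)).comp
        (Algebra.TensorProduct.map c.comul c.comul) := by
    ext <;> simp
  have h3 : Algebra.TensorProduct.productMap (Algebra.TensorProduct.productMap f.hom g.hom)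
        (Algebra.TensorProduct.productMap f.hom h.hom) =
      (Algebra.TensorProduct.productMap f.hom
        (Algebra.TensorProduct.productMap g.hom h.hom)).comp
      ((Algebra.TensorProduct.map (Algebra.TensorProduct.lmul' R) (AlgHom.id R (A ⊗[R] A))).comp
      (Algebra.TensorProduct.tensorTensorTensorComm R R R R A A A A).toAlgHom) := by
    ext <;> simp [Algebra.TensorProduct.one_def]
  rw [h1, h2, h3, AlgHom.comp_assoc, c.codistrib]
  simp only [AlgHom.comp_assoc]

theorem constPoint_add (r s : R) :
    c.constPoint B (r + s) = c.constPoint B r + c.constPoint B s := by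
  change (Algebra.ofId R B).comp (c.coconst (r + s)) =
    (Algebra.TensorProduct.productMap ((Algebra.ofId R B).comp (c.coconst r))
      ((Algebra.ofId R B).comp (c.coconst s))).comp c.coadd
  rw [c.coconst_add, ← AlgHom.comp_assoc _ _ c.coadd,
    ← Algebra.TensorProduct.productMap_eq_comp_map, conv_comp_aux]

theorem constPoint_mul (r s : R) :
    c.constPoint B (r * s) = c.constPoint B r * c.constPoint B s := by
  change (Algebra.ofId R B).comp (c.coconst (r * s)) =
    (Algebra.TensorProduct.productMap ((Algebra.ofId R B).comp (c.coconst r))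
      ((Algebra.ofId R B).comp (c.coconst s))).comp c.comul
  rw [c.coconst_mul, ← AlgHom.comp_assoc _ _ c.comul,
    ← Algebra.TensorProduct.productMap_eq_comp_map, conv_comp_aux]

/-- The ring structure on the points is the one given by the co-operations. -/
instance : CommRing (c.Points B) where
  add_assoc := c.points_add_assoc
  zero_add := c.points_zero_add
  add_zero f := by rw [c.points_add_comm, c.points_zero_add]
  add_comm := c.points_add_comm
  neg_add_cancel := c.points_neg_add_cancel
  mul_assoc := c.points_mul_assoc
  mul_comm := c.points_mul_comm
  one_mul := c.points_one_mul
  mul_one f := by rw [c.points_mul_comm, c.points_one_mul]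
  left_distrib := c.points_left_distrib
  right_distrib f g h := by
    rw [c.points_mul_comm, c.points_left_distrib, c.points_mul_comm h f, c.points_mul_comm h g]
  zero_mul f := by
    have hz : (0 : c.Points B) + 0 = 0 := c.points_zero_add 0
    have h1 : f * 0 + f * 0 = f * 0 := by rw [← c.points_left_distrib, hz]
    have h2 : -(f * 0) + (f * 0 + f * 0) = -(f * 0) + f * 0 := by rw [h1]
    rw [← c.points_add_assoc, c.points_neg_add_cancel, c.points_zero_add] at h2
    rw [c.points_mul_comm, h2]
  mul_zero f := by
    have hz : (0 : c.Points B) + 0 = 0 := c.points_zero_add 0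
    have h1 : f * 0 + f * 0 = f * 0 := by rw [← c.points_left_distrib, hz]
    have h2 : -(f * 0) + (f * 0 + f * 0) = -(f * 0) + f * 0 := by rw [h1]
    rw [← c.points_add_assoc, c.points_neg_add_cancel, c.points_zero_add] at h2
    exact h2
  nsmul := nsmulRec
  zsmul := zsmulRec

/-- The constants as a ring homomorphism into the ring of points. -/
def constHom (B : Type u) [CommRing B] [Algebra R B] : R →+* c.Points B where
  toFun := c.constPoint B
  map_one' := rfl
  map_mul' := c.constPoint_mul
  map_zero' := rfl
  map_add' := c.constPoint_add

instance : Algebra R (c.Points B) := (c.constHom B).toAlgebra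

theorem algebraMap_points (r : R) : algebraMap R (c.Points B) r = c.constPoint B r := rfl

/-- Composition with `k : B → C` as an algebra homomorphism between the algebras of points. -/
def mapPoints {C : Type u} [CommRing C] [Algebra R C] (k : B →ₐ[R] C) :
    c.Points B →ₐ[R] c.Points C where
  toFun f := c.point (k.comp f.hom)
  map_one' := by
    refine Points.ext fun a => ?_
    simp [one_hom, Algebra.ofId_apply]
  map_mul' f g := conv_comp_aux c.comul k f.hom g.hom
  map_zero' := by
    refine Points.ext fun a => ?_
    simp [zero_hom, Algebra.ofId_apply]
  map_add' f g := conv_comp_aux c.coadd k f.hom g.hom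
  commutes' r := by
    refine Points.ext fun a => ?_
    simp [algebraMap_points, constPoint_hom, Algebra.ofId_apply]

@[simp] theorem mapPoints_hom {C : Type u} [CommRing C] [Algebra R C] (k : B →ₐ[R] C)
    (f : c.Points B) : (c.mapPoints k f).hom = k.comp f.hom := rfl

/-- The covariant functor from commutative `R`-algebras to commutative `R`-algebras that is
represented by the co-object `A`, namely `B ↦ Hom(A, B)`. -/
def cov : CommAlgCat.{u} R ⥤ CommAlgCat.{u} R where
  obj B := CommAlgCat.of R (c.Points B)
  map k := CommAlgCat.ofHom (c.mapPoints k.hom)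

/-- An ideal that is also a co-ideal: the co-operations send it into the kernel of
`A ⊗ A → A/I ⊗ A/I` (for the binary ones), into `I` (for the co-inverse)
and to `0` (for the constants). -/
structure IsCoideal (I : Ideal A) : Prop where
  coadd_mem : ∀ f ∈ I, c.coadd f ∈
    I.map (Algebra.TensorProduct.includeLeft : A →ₐ[R] A ⊗[R] A) ⊔
    I.map (Algebra.TensorProduct.includeRight : A →ₐ[R] A ⊗[R] A)
  comul_mem : ∀ f ∈ I, c.comul f ∈
    I.map (Algebra.TensorProduct.includeLeft : A →ₐ[R] A ⊗[R] A) ⊔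
    I.map (Algebra.TensorProduct.includeRight : A →ₐ[R] A ⊗[R] A)
  coneg_mem : ∀ f ∈ I, c.coneg f ∈ I
  coconst_eq_zero : ∀ r : R, ∀ f ∈ I, c.coconst r f = 0

end CoAlgObj

/-- Morphisms of co-(commutative `R`-algebra) objects: algebra homomorphisms that intertwine
the co-operations. -/
structure IsCoAlgHom {A A' : Type u} [CommRing A] [Algebra R A] [CommRing A'] [Algebra R A']
    (c : CoAlgObj R A) (c' : CoAlgObj R A') (F : A →ₐ[R] A') : Prop where
  coadd_comm : (Algebra.TensorProduct.map F F).comp c.coadd = c'.coadd.comp F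
  comul_comm : (Algebra.TensorProduct.map F F).comp c.comul = c'.comul.comp F
  coneg_comm : F.comp c.coneg = c'.coneg.comp F
  coconst_comm : ∀ r : R, c.coconst r = (c'.coconst r).comp F

end CoObjects

section Monoids

variable (R : Type u) [CommRing R] (A : Type u) [CommRing A] [Algebra R A]

/-- A Tall-Wraith monoid with underlying commutative `R`-algebra `A`: a monoid for the
Tall-Wraith product `⊙` on the co-(commutative `R`-algebra) objects.  By definition `⊙` is
composition of represented functors, transported along the contravariant equivalence of the
category of co-objects with the category of representable endofunctors of the category of
commutative `R`-algebras.  Hence `A ⊙ A` represents `cov A ⋙ cov A` and the unit represents the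
identity functor; a unit `I → A` is a natural transformation `cov A ⟶ 𝟭`, a multiplication
`A ⊙ A → A` is a natural transformation `cov A ⟶ cov A ⋙ cov A`, and the monoid axioms say that
these form a comonad. -/
structure TWMonoid extends CoAlgObj R A where
  counit : toCoAlgObj.cov ⟶ 𝟭 (CommAlgCat.{u} R)
  comult : toCoAlgObj.cov ⟶ toCoAlgObj.cov ⋙ toCoAlgObj.cov
  coassoc : ∀ B : CommAlgCat.{u} R,
    comult.app B ≫ toCoAlgObj.cov.map (comult.app B) =
      comult.app B ≫ comult.app (toCoAlgObj.cov.obj B)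
  left_counit : ∀ B : CommAlgCat.{u} R,
    comult.app B ≫ counit.app (toCoAlgObj.cov.obj B) = 𝟙 _
  right_counit : ∀ B : CommAlgCat.{u} R,
    comult.app B ≫ toCoAlgObj.cov.map (counit.app B) = 𝟙 _

variable {R A}

namespace TWMonoid

/-- The comonad on commutative `R`-algebras that is given by a Tall-Wraith monoid. -/
def toComonad (T : TWMonoid R A) : Comonad (CommAlgCat.{u} R) where
  toFunctor := T.cov
  ε := T.counit
  δ := T.comult
  coassoc := T.coassoc
  left_counit := T.left_counit
  right_counit := T.right_counit

/-- The unit, evaluated at `φ : A → B`; this is an element of `B`. -/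
def counitAt (T : TWMonoid R A) {B : Type u} [CommRing B] [Algebra R B] (φ : A →ₐ[R] B) : B :=
  (T.counit.app (CommAlgCat.of R B)).hom (T.point φ)

/-- The multiplication, evaluated at `φ : A → B`; this is a homomorphism from `A` to the algebra
`Hom(A, B)`, and `T.comultAt φ g f` is the image under `φ` of the composite "`f` after `g`". -/
def comultAt (T : TWMonoid R A) {B : Type u} [CommRing B] [Algebra R B] (φ : A →ₐ[R] B)
    (g f : A) : B :=
  let ψ : T.Points (T.Points B) := (T.comult.app (CommAlgCat.of R B)).hom (T.point φ)
  let ψg : T.Points B := ψ.hom g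
  ψg.hom f

/-- The composition on the elements of a Tall-Wraith monoid, "`f` after `g`": the image of the
class of `(g, f)` under the multiplication `A ⊙ A → A`. -/
def comp (T : TWMonoid R A) (f g : A) : A := T.comultAt (AlgHom.id R A) g f

/-- An ideal is compatible with composition if composition descends to the quotient. -/
structure IsCompCompatible (T : TWMonoid R A) (I : Ideal A) : Prop where
  comp_sub_mem : ∀ f : A, ∀ g ∈ I, T.comp f g - T.comp f 0 ∈ I
  comp_mem : ∀ f ∈ I, ∀ g : A, T.comp f g ∈ I

/-- Construction of a Tall-Wraith monoid from an element `e` (the unit) and a composition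
`(f, g) ↦ (m g).hom f` ("`f` after `g`"). -/
def ofComp (c : CoAlgObj R A) (m : A →ₐ[R] c.Points A) (e : A)
    (e_add : c.coadd e = e ⊗ₜ[R] 1 + 1 ⊗ₜ[R] e)
    (e_mul : c.comul e = e ⊗ₜ[R] e)
    (e_const : ∀ r : R, c.coconst r e = r)
    (m_add : ∀ (B : Type u) [CommRing B] [Algebra R B] (φ ψ : c.Points B),
      c.point ((c.mapPoints (φ + ψ).hom).comp m) =
        c.point ((c.mapPoints φ.hom).comp m) + c.point ((c.mapPoints ψ.hom).comp m))
    (m_mul : ∀ (B : Type u) [CommRing B] [Algebra R B] (φ ψ : c.Points B),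
      c.point ((c.mapPoints (φ * ψ).hom).comp m) =
        c.point ((c.mapPoints φ.hom).comp m) * c.point ((c.mapPoints ψ.hom).comp m))
    (m_const : ∀ (B : Type u) [CommRing B] [Algebra R B] (r : R),
      c.point ((c.mapPoints (c.constPoint B r).hom).comp m) = c.constPoint (c.Points B) r)
    (m_assoc : ∀ f g h : A, (m h).hom ((m g).hom f) = (m ((m h).hom g)).hom f)
    (m_left : ∀ g : A, (m g).hom e = g)
    (m_right : ∀ f : A, (m e).hom f = f) : TWMonoid R A where
  toCoAlgObj := c
  counit :=
    { app := fun B => CommAlgCat.ofHom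
        { toFun := fun φ : c.Points B => φ.hom e
          map_one' := by
            simp [CoAlgObj.one_hom, e_const, Algebra.ofId_apply]
          map_mul' := fun φ ψ => by
            simp [CoAlgObj.mul_hom, e_mul]
          map_zero' := by
            simp [CoAlgObj.zero_hom, e_const, Algebra.ofId_apply]
          map_add' := fun φ ψ => by
            simp [CoAlgObj.add_hom, e_add]
          commutes' := fun r => by
            simp [CoAlgObj.algebraMap_points, CoAlgObj.constPoint_hom, e_const,
              Algebra.ofId_apply] }
      naturality := fun B C k => rfl }
  comult :=
    { app := fun B => CommAlgCat.ofHom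
        { toFun := fun φ : c.Points B => c.point ((c.mapPoints φ.hom).comp m)
          map_one' := m_const B 1
          map_mul' := m_mul B
          map_zero' := m_const B 0
          map_add' := m_add B
          commutes' := m_const B }
      naturality := fun B C k => rfl }
  coassoc B := by
    refine CommAlgCat.hom_ext (AlgHom.ext fun φ => ?_)
    refine CoAlgObj.Points.ext (c := c) fun g => ?_
    refine CoAlgObj.Points.ext (c := c) fun h => ?_
    refine CoAlgObj.Points.ext (c := c) fun f => ?_
    exact congrArg (CoAlgObj.Points.hom (c := c) φ) (m_assoc f h g)
  left_counit B := by
    refine CommAlgCat.hom_ext (AlgHom.ext fun φ => ?_)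
    refine CoAlgObj.Points.ext (c := c) fun f => ?_
    exact congrArg (CoAlgObj.Points.hom (c := c) φ) (m_right f)
  right_counit B := by
    refine CommAlgCat.hom_ext (AlgHom.ext fun φ => ?_)
    refine CoAlgObj.Points.ext (c := c) fun g => ?_
    exact congrArg (CoAlgObj.Points.hom (c := c) φ) (m_left g)

end TWMonoid

/-- Morphisms of Tall-Wraith monoids: morphisms of co-objects `F` such that the natural
transformation `φ ↦ φ ∘ F` of represented functors is compatible with units and
multiplications. -/
structure IsTWHom {A A' : Type u} [CommRing A] [Algebra R A] [CommRing A'] [Algebra R A']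
    (T : TWMonoid R A) (T' : TWMonoid R A') (F : A →ₐ[R] A') : Prop
    extends IsCoAlgHom T.toCoAlgObj T'.toCoAlgObj F where
  counit_comm : ∀ (B : Type u) [CommRing B] [Algebra R B] (φ : A' →ₐ[R] B),
    T.counitAt (φ.comp F) = T'.counitAt φ
  comult_comm : ∀ (B : Type u) [CommRing B] [Algebra R B] (φ : A' →ₐ[R] B) (g f : A),
    T.comultAt (φ.comp F) g f = T'.comultAt φ (F g) (F f)

end Monoids

section PolynomialMonoid

variable (R : Type u) [CommRing R]

open Polynomial

/-- The co-operations on the free `R`-algebra `R[x]` on one generator: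
`Δ⁺ x = x ⊗ 1 + 1 ⊗ x`, `Δ^× x = x ⊗ x`, the co-inverse sends `x` to `-x`, and the constant `r`
gives the evaluation at `r`. -/
noncomputable def polyCoAlg : CoAlgObj R R[X] where
  coadd := aeval ((X : R[X]) ⊗ₜ[R] (1 : R[X]) + (1 : R[X]) ⊗ₜ[R] (X : R[X]))
  comul := aeval ((X : R[X]) ⊗ₜ[R] (X : R[X]))
  coneg := aeval (-X)
  coconst r := aeval r
  coadd_coassoc := by
    apply Polynomial.algHom_ext
    simp [TensorProduct.add_tmul, TensorProduct.tmul_add, Algebra.TensorProduct.one_def, add_assoc]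
  coadd_cocomm := by
    apply Polynomial.algHom_ext
    simp [add_comm]
  coadd_counit := by
    apply Polynomial.algHom_ext
    simp
  coadd_coneg := by
    apply Polynomial.algHom_ext
    simp
  comul_coassoc := by
    apply Polynomial.algHom_ext
    simp
  comul_cocomm := by
    apply Polynomial.algHom_ext
    simp
  comul_counit := by
    apply Polynomial.algHom_ext
    simp
  codistrib := by
    apply Polynomial.algHom_ext
    simp [TensorProduct.tmul_add, Algebra.TensorProduct.one_def]
  coconst_add r s := by
    apply Polynomial.algHom_ext
    simp
  coconst_mul r s := by
    apply Polynomial.algHom_ext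
    simp

/-- The points of `R[x]` in `B` are the elements of `B`. -/
noncomputable def polyPt (B : Type u) [CommRing B] [Algebra R B] :
    (polyCoAlg R).Points B →ₐ[R] B where
  toFun φ := φ.hom X
  map_one' := by
    change (Algebra.ofId R B) (aeval (1 : R) (X : R[X])) = 1
    simp
  map_mul' φ ψ := by
    change Algebra.TensorProduct.productMap φ.hom ψ.hom
      (aeval ((X : R[X]) ⊗ₜ[R] (X : R[X])) (X : R[X])) = _
    simp
  map_zero' := by
    change (Algebra.ofId R B) (aeval (0 : R) (X : R[X])) = 0
    simp
  map_add' φ ψ := by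
    change Algebra.TensorProduct.productMap φ.hom ψ.hom
      (aeval ((X : R[X]) ⊗ₜ[R] (1 : R[X]) + (1 : R[X]) ⊗ₜ[R] (X : R[X])) (X : R[X])) = _
    simp
  commutes' r := by
    change (Algebra.ofId R B) (aeval r (X : R[X])) = _
    simp [Algebra.ofId_apply]

theorem polyPt_injective (B : Type u) [CommRing B] [Algebra R B] :
    Function.Injective (polyPt R B) := fun _ _ h => Polynomial.algHom_ext h

/-- Substitution `g ↦ (f ↦ f ∘ g)` on polynomials, as an algebra homomorphism from `R[x]` to
the algebra `Hom(R[x], R[x])` that is given by the co-operations of the first `R[x]`. -/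
noncomputable def polySubst : R[X] →ₐ[R] (polyCoAlg R).Points R[X] where
  toFun g := (polyCoAlg R).point (aeval g)
  map_one' := Polynomial.algHom_ext (by
    change aeval (1 : R[X]) X = (Algebra.ofId R R[X]) (aeval (1 : R) X)
    simp)
  map_mul' g h := Polynomial.algHom_ext (by
    change aeval (g * h) X = Algebra.TensorProduct.productMap (aeval g) (aeval h)
      (aeval ((X : R[X]) ⊗ₜ[R] (X : R[X])) X)
    simp)
  map_zero' := Polynomial.algHom_ext (by
    change aeval (0 : R[X]) X = (Algebra.ofId R R[X]) (aeval (0 : R) X)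
    simp)
  map_add' g h := Polynomial.algHom_ext (by
    change aeval (g + h) X = Algebra.TensorProduct.productMap (aeval g) (aeval h)
      (aeval ((X : R[X]) ⊗ₜ[R] (1 : R[X]) + (1 : R[X]) ⊗ₜ[R] (X : R[X])) X)
    simp)
  commutes' r := Polynomial.algHom_ext (by
    change aeval (algebraMap R R[X] r) X = (Algebra.ofId R R[X]) (aeval r X)
    simp [Algebra.ofId_apply])

/-- The Tall-Wraith monoid `R[x]` (the unit object): the composition is the composition of
polynomials and the unit is `x`. -/
noncomputable def polyTW : TWMonoid R R[X] :=
  TWMonoid.ofComp (polyCoAlg R) (polySubst R) X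
    (by simp [polyCoAlg])
    (by simp [polyCoAlg])
    (by simp [polyCoAlg])
    (fun B _ _ φ ψ => by
      apply polyPt_injective
      apply polyPt_injective
      rw [map_add, map_add]
      have h (χ : (polyCoAlg R).Points B) : polyPt R B (polyPt R _ ((polyCoAlg R).point
        (((polyCoAlg R).mapPoints χ.hom).comp (polySubst R)))) = polyPt R B χ :=
        congrArg χ.hom (aeval_X (X : R[X]))
      rw [h, h, h, map_add])
    (fun B _ _ φ ψ => by
      apply polyPt_injective
      apply polyPt_injective
      rw [map_mul, map_mul]
      have h (χ : (polyCoAlg R).Points B) : polyPt R B (polyPt R _ ((polyCoAlg R).point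
        (((polyCoAlg R).mapPoints χ.hom).comp (polySubst R)))) = polyPt R B χ :=
        congrArg χ.hom (aeval_X (X : R[X]))
      rw [h, h, h, map_mul])
    (fun B _ _ r => by
      apply polyPt_injective
      apply polyPt_injective
      rw [← CoAlgObj.algebraMap_points, ← CoAlgObj.algebraMap_points, AlgHom.commutes,
        AlgHom.commutes]
      have h (χ : (polyCoAlg R).Points B) : polyPt R B (polyPt R _ ((polyCoAlg R).point
        (((polyCoAlg R).mapPoints χ.hom).comp (polySubst R)))) = polyPt R B χ :=
        congrArg χ.hom (aeval_X (X : R[X]))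
      rw [h, AlgHom.commutes])
    (fun f g h => by
      change aeval h (aeval g f) = aeval (aeval h g) f
      rw [← Polynomial.aeval_algHom_apply])
    (fun g => aeval_X g)
    (fun f => aeval_X_left_apply f)

theorem polyTW_comp (f g : R[X]) : (polyTW R).comp f g = f.comp g := by
  change aeval g f = f.comp g
  rw [Polynomial.aeval_def, Polynomial.comp, Polynomial.algebraMap_eq]

end PolynomialMonoid

section ToyMonoid

set_option linter.unusedSectionVars false

variable (R : Type u) [CommRing R]

/-- The contravariant action of a map of sets `u : S → S'` on functions with values in `R`. -/
def pullback {S S' : Type u} (u : S → S') : (S' → R) →ₐ[R] (S → R) where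
  toFun f := f ∘ u
  map_one' := rfl
  map_mul' _ _ := rfl
  map_zero' := rfl
  map_add' _ _ := rfl
  commutes' _ := rfl

/-- The Künneth map `R^S ⊗ R^S' → R^(S × S')`, induced by the two projections. -/
noncomputable def kunneth (S S' : Type u) : (S → R) ⊗[R] (S' → R) →ₐ[R] (S × S' → R) :=
  Algebra.TensorProduct.productMap (pullback R Prod.fst) (pullback R Prod.snd)

@[simp] theorem kunneth_tmul {S S' : Type u} (f : S → R) (g : S' → R) (p : S × S') :
    kunneth R S S' (f ⊗ₜ[R] g) p = f p.1 * g p.2 := rfl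

/-- Evaluation at a point of `S` in the first tensor factor. -/
noncomputable def evalLeft {S : Type u} (M : Type u) [CommRing M] [Algebra R M] (s : S) :
    (S → R) ⊗[R] M →ₐ[R] M :=
  Algebra.TensorProduct.productMap ((Algebra.ofId R M).comp (Pi.evalAlgHom R (fun _ => R) s))
    (AlgHom.id R M)

theorem evalLeft_tmul {S : Type u} (M : Type u) [CommRing M] [Algebra R M] (s : S)
    (f : S → R) (x : M) : evalLeft R M s (f ⊗ₜ[R] x) = f s • x := by
  simp [evalLeft, Algebra.ofId_apply, Algebra.smul_def]

theorem evalLeft_ext {S : Type u} [Finite S] {M : Type u} [CommRing M] [Algebra R M]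
    {z w : (S → R) ⊗[R] M} (h : ∀ s, evalLeft R M s z = evalLeft R M s w) : z = w := by
  classical
  cases nonempty_fintype S
  have key (y : (S → R) ⊗[R] M) :
      y = ∑ s, (Pi.single s (1 : R) : S → R) ⊗ₜ[R] evalLeft R M s y := by
    induction y with
    | zero => simp
    | add a b ha hb =>
      simp only [map_add, TensorProduct.tmul_add, Finset.sum_add_distrib]
      rw [← ha, ← hb]
    | tmul f x =>
      simp only [evalLeft_tmul, TensorProduct.tmul_smul, TensorProduct.smul_tmul',
        ← TensorProduct.sum_tmul]
      congr 1
      ext t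
      simp [Finset.sum_apply, Pi.single_apply]
  rw [key z, key w]
  simp only [h]

theorem eval_kunneth {S S' : Type u} (z : (S → R) ⊗[R] (S' → R)) (p : S × S') :
    kunneth R S S' z p = evalLeft R (S' → R) p.1 z p.2 := by
  induction z with
  | zero => simp
  | add a b ha hb => simp [ha, hb]
  | tmul f g => simp [evalLeft_tmul]

theorem kunneth_bijective (S S' : Type u) [Finite S] [Finite S'] :
    Function.Bijective (kunneth R S S') := by
  constructor
  · intro z w h
    refine evalLeft_ext R fun s => funext fun t => ?_
    have := congrFun h (s, t)
    rwa [eval_kunneth, eval_kunneth] at this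
  · classical
    cases nonempty_fintype S
    intro F
    refine ⟨∑ s, (Pi.single s (1 : R) : S → R) ⊗ₜ[R] (fun t => F (s, t)), ?_⟩
    ext p
    simp [Finset.sum_apply, map_sum, Pi.single_apply]

variable [Finite R]

/-- The binary co-operation on `R^R` that is induced by a binary operation on `R`:
pull back along the operation and apply the inverse of the Künneth isomorphism. -/
noncomputable def toyCoop (op : R × R → R) : (R → R) →ₐ[R] (R → R) ⊗[R] (R → R) :=
  (AlgEquiv.ofBijective (kunneth R R R) (kunneth_bijective R R R)).symm.toAlgHom.comp
    (pullback R op)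

theorem kunneth_toyCoop (op : R × R → R) (f : R → R) :
    kunneth R R R (toyCoop R op f) = f ∘ op :=
  (AlgEquiv.ofBijective (kunneth R R R) (kunneth_bijective R R R)).apply_symm_apply (f ∘ op)

/-- Evaluation at `(r, s, t)` on the triple tensor power. -/
noncomputable def eval3 (r s t : R) : (R → R) ⊗[R] ((R → R) ⊗[R] (R → R)) →ₐ[R] R :=
  ((Pi.evalAlgHom R (fun _ : R × R => R) (s, t)).comp (kunneth R R R)).comp (evalLeft R _ r)

theorem eval3_ext {z w : (R → R) ⊗[R] ((R → R) ⊗[R] (R → R))}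
    (h : ∀ r s t, eval3 R r s t z = eval3 R r s t w) : z = w :=
  evalLeft_ext R fun r => (kunneth_bijective R R R).1 (funext fun p => h r p.1 p.2)

theorem eval3_tmul (r s t : R) (f : R → R) (z : (R → R) ⊗[R] (R → R)) :
    eval3 R r s t (f ⊗ₜ[R] z) = f r * kunneth R R R z (s, t) := by
  simp [eval3, evalLeft_tmul]

theorem eval3_assoc_tmul (r s t : R) (z : (R → R) ⊗[R] (R → R)) (f : R → R) :
    eval3 R r s t (Algebra.TensorProduct.assoc R R R (R → R) (R → R) (R → R) (z ⊗ₜ[R] f)) =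
      kunneth R R R z (r, s) * f t := by
  induction z with
  | zero => simp
  | add a b ha hb => simp [TensorProduct.add_tmul, ha, hb, add_mul]
  | tmul g k => simp [eval3_tmul, mul_assoc]

theorem eval3_map_left (op : R × R → R) (r s t : R) (z : (R → R) ⊗[R] (R → R)) :
    eval3 R r s t (Algebra.TensorProduct.assoc R R R (R → R) (R → R) (R → R)
      (Algebra.TensorProduct.map (toyCoop R op) (AlgHom.id R (R → R)) z)) =
      kunneth R R R z (op (r, s), t) := by
  induction z with
  | zero => simp
  | add a b ha hb => simp [ha, hb]
  | tmul g k => simp [eval3_assoc_tmul, kunneth_toyCoop]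

theorem eval3_map_right (op : R × R → R) (r s t : R) (z : (R → R) ⊗[R] (R → R)) :
    eval3 R r s t (Algebra.TensorProduct.map (AlgHom.id R (R → R)) (toyCoop R op) z) =
      kunneth R R R z (r, op (s, t)) := by
  induction z with
  | zero => simp
  | add a b ha hb => simp [ha, hb]
  | tmul g k => simp [eval3_tmul, kunneth_toyCoop]

theorem eval3_distrib (op : R × R → R) (r s t : R) (z : (R → R) ⊗[R] (R → R)) :
    eval3 R r s t (Algebra.TensorProduct.map (Algebra.TensorProduct.lmul' R)
      (AlgHom.id R ((R → R) ⊗[R] (R → R)))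
      (Algebra.TensorProduct.tensorTensorTensorComm R R R R (R → R) (R → R) (R → R) (R → R)
      (Algebra.TensorProduct.map (toyCoop R op) (toyCoop R op) z))) =
      kunneth R R R z (op (r, s), op (r, t)) := by
  have key (x y : (R → R) ⊗[R] (R → R)) :
      eval3 R r s t (Algebra.TensorProduct.map (Algebra.TensorProduct.lmul' R)
        (AlgHom.id R ((R → R) ⊗[R] (R → R)))
        (Algebra.TensorProduct.tensorTensorTensorComm R R R R (R → R) (R → R) (R → R) (R → R)
        (x ⊗ₜ[R] y))) = kunneth R R R x (r, s) * kunneth R R R y (r, t) := by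
    induction x with
    | zero => simp
    | add a b ha hb => simp [TensorProduct.add_tmul, ha, hb, add_mul]
    | tmul f g =>
      induction y with
      | zero => simp
      | add a b ha hb => simp [TensorProduct.tmul_add, ha, hb, mul_add]
      | tmul h k =>
        simp [eval3_tmul]
        ring
  induction z with
  | zero => simp
  | add a b ha hb => simp [ha, hb]
  | tmul g k => simp [key, kunneth_toyCoop]

theorem kunneth_comm (z : (R → R) ⊗[R] (R → R)) (p : R × R) :
    kunneth R R R (Algebra.TensorProduct.comm R (R → R) (R → R) z) p =
      kunneth R R R z p.swap := by
  induction z with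
  | zero => simp
  | add a b ha hb => simp [ha, hb]
  | tmul g k => simp [mul_comm]

theorem lid_map_eval (r s : R) (z : (R → R) ⊗[R] (R → R)) :
    (Algebra.TensorProduct.lid R (R → R) (Algebra.TensorProduct.map
      (Pi.evalAlgHom R (fun _ : R => R) r) (AlgHom.id R (R → R)) z)) s =
      kunneth R R R z (r, s) := by
  induction z with
  | zero => simp
  | add a b ha hb => simp [ha, hb]
  | tmul g k => simp

theorem lmul_map_pullback (u : R → R) (s : R) (z : (R → R) ⊗[R] (R → R)) :
    (Algebra.TensorProduct.lmul' R (Algebra.TensorProduct.map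
      (pullback R u) (AlgHom.id R (R → R)) z)) s = kunneth R R R z (u s, s) := by
  induction z with
  | zero => simp
  | add a b ha hb => simp [ha, hb]
  | tmul g k =>
    simp only [Algebra.TensorProduct.map_tmul, Algebra.TensorProduct.lmul'_apply_tmul]
    rfl

theorem lmul_map_eval (r s : R) (z : (R → R) ⊗[R] (R → R)) :
    (Algebra.TensorProduct.lmul' R (Algebra.TensorProduct.map
      (Pi.evalAlgHom R (fun _ : R => R) r) (Pi.evalAlgHom R (fun _ : R => R) s) z)) =
      kunneth R R R z (r, s) := by
  induction z with
  | zero => simp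
  | add a b ha hb => simp [ha, hb]
  | tmul g k => simp

/-- The co-operations on `R^R = Hom(|R|, |R|)` that are induced by the operations of the finite
ring `R` on itself. -/
noncomputable def toyCoAlg : CoAlgObj R (R → R) where
  coadd := toyCoop R fun p => p.1 + p.2
  comul := toyCoop R fun p => p.1 * p.2
  coneg := pullback R fun r => -r
  coconst r := Pi.evalAlgHom R (fun _ : R => R) r
  coadd_coassoc := AlgHom.ext fun f => eval3_ext R fun r s t =>
    (eval3_map_left R _ r s t _).trans
      (by rw [AlgHom.comp_apply, eval3_map_right]; simp [kunneth_toyCoop, add_assoc])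
  coadd_cocomm := AlgHom.ext fun f => (kunneth_bijective R R R).1 (funext fun p =>
    (kunneth_comm R _ p).trans (by simp [kunneth_toyCoop, add_comm]))
  coadd_counit := AlgHom.ext fun f => funext fun s =>
    (lid_map_eval R 0 s _).trans (by simp [kunneth_toyCoop])
  coadd_coneg := AlgHom.ext fun f => funext fun s =>
    (lmul_map_pullback R _ s _).trans (by simp [kunneth_toyCoop, Algebra.ofId_apply])
  comul_coassoc := AlgHom.ext fun f => eval3_ext R fun r s t =>
    (eval3_map_left R _ r s t _).trans
      (by rw [AlgHom.comp_apply, eval3_map_right]; simp [kunneth_toyCoop, mul_assoc])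
  comul_cocomm := AlgHom.ext fun f => (kunneth_bijective R R R).1 (funext fun p =>
    (kunneth_comm R _ p).trans (by simp [kunneth_toyCoop, mul_comm]))
  comul_counit := AlgHom.ext fun f => funext fun s =>
    (lid_map_eval R 1 s _).trans (by simp [kunneth_toyCoop])
  codistrib := AlgHom.ext fun f => eval3_ext R fun r s t => by
    refine (eval3_map_right R _ r s t _).trans (Eq.trans ?_ (eval3_distrib R _ r s t _).symm)
    simp [kunneth_toyCoop, mul_add]
  coconst_add r s := AlgHom.ext fun f => by
    refine Eq.trans ?_ (lmul_map_eval R r s _).symm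
    simp [kunneth_toyCoop]
  coconst_mul r s := AlgHom.ext fun f => by
    refine Eq.trans ?_ (lmul_map_eval R r s _).symm
    simp [kunneth_toyCoop]

theorem productMap_pullback {S : Type u} (g h : S → R) (z : (R → R) ⊗[R] (R → R)) (s : S) :
    Algebra.TensorProduct.productMap (pullback R g) (pullback R h) z s =
      kunneth R R R z (g s, h s) := by
  induction z with
  | zero => simp
  | add a b ha hb => simp [ha, hb]
  | tmul k l => rfl

/-- Composition `g ↦ (f ↦ f ∘ g)` as an algebra homomorphism from `R^S` to the algebra
`Hom(R^R, R^S)` that is given by the co-operations of `R^R`. -/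
noncomputable def toySubst (S : Type u) : (S → R) →ₐ[R] (toyCoAlg R).Points (S → R) where
  toFun g := (toyCoAlg R).point (pullback R g)
  map_one' := rfl
  map_mul' g h := AlgHom.ext fun f => funext fun s => by
    refine Eq.trans ?_ (productMap_pullback R g h _ s).symm
    change _ = kunneth R R R (toyCoop R _ f) (g s, h s)
    rw [kunneth_toyCoop]
    rfl
  map_zero' := rfl
  map_add' g h := AlgHom.ext fun f => funext fun s => by
    refine Eq.trans ?_ (productMap_pullback R g h _ s).symm
    change _ = kunneth R R R (toyCoop R _ f) (g s, h s)
    rw [kunneth_toyCoop]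
    rfl
  commutes' r := rfl

theorem toySubst_coop (op : R × R → R) {B : Type u} [CommRing B] [Algebra R B]
    (φ ψ : (R → R) →ₐ[R] B) (χ : (toyCoAlg R).Points B)
    (hχ : χ.hom = (Algebra.TensorProduct.productMap φ ψ).comp (toyCoop R op)) :
    ((toyCoAlg R).mapPoints χ.hom).comp (toySubst R R) =
      (Algebra.TensorProduct.productMap (((toyCoAlg R).mapPoints φ).comp (toySubst R R))
        (((toyCoAlg R).mapPoints ψ).comp (toySubst R R))).comp (toyCoop R op) := by
  let κ := AlgEquiv.ofBijective (kunneth R R R) (kunneth_bijective R R R)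
  let θ : (R × R → R) →ₐ[R] B :=
    (Algebra.TensorProduct.productMap φ ψ).comp κ.symm.toAlgHom
  have h1 : Algebra.TensorProduct.productMap (((toyCoAlg R).mapPoints φ).comp (toySubst R R))
      (((toyCoAlg R).mapPoints ψ).comp (toySubst R R)) =
      (((toyCoAlg R).mapPoints θ).comp (toySubst R (R × R))).comp (kunneth R R R) := by
    apply Algebra.TensorProduct.ext
    · refine AlgHom.ext fun g => ?_
      refine CoAlgObj.Points.ext fun f => ?_
      have e : kunneth R R R ((f ∘ g) ⊗ₜ[R] 1) = f ∘ (kunneth R R R (g ⊗ₜ[R] 1)) := by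
        funext p
        simp
      have e' : κ.symm (f ∘ (kunneth R R R (g ⊗ₜ[R] 1))) = (f ∘ g) ⊗ₜ[R] 1 :=
        κ.symm_apply_eq.2 e.symm
      have e2 := congrArg (Algebra.TensorProduct.productMap φ ψ) e'
      rw [Algebra.TensorProduct.productMap_left_apply] at e2
      refine Eq.trans ?_ e2.symm
      rw [Algebra.TensorProduct.productMap_left]
      rfl
    · refine AlgHom.ext fun g => ?_
      refine CoAlgObj.Points.ext fun f => ?_
      have e : kunneth R R R (1 ⊗ₜ[R] (f ∘ g)) = f ∘ (kunneth R R R (1 ⊗ₜ[R] g)) := by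
        funext p
        simp
      have e' : κ.symm (f ∘ (kunneth R R R (1 ⊗ₜ[R] g))) = 1 ⊗ₜ[R] (f ∘ g) :=
        κ.symm_apply_eq.2 e.symm
      have e2 := congrArg (Algebra.TensorProduct.productMap φ ψ) e'
      rw [Algebra.TensorProduct.productMap_right_apply] at e2
      refine Eq.trans ?_ e2.symm
      exact congrArg (fun x : (toyCoAlg R).Points B => x.hom f)
        (Algebra.TensorProduct.productMap_right_apply _ _ g)
  rw [h1]
  refine AlgHom.ext fun g => ?_
  refine CoAlgObj.Points.ext fun f => ?_
  change χ.hom (f ∘ g) = θ (f ∘ kunneth R R R (toyCoop R op g))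
  rw [kunneth_toyCoop, hχ]
  rfl

/-- The Tall-Wraith monoid `R^R = Hom(|R|, |R|)` of a finite ring `R`: the composition is the
composition of functions and the unit is the identity function. -/
noncomputable def toyTW : TWMonoid R (R → R) :=
  TWMonoid.ofComp (toyCoAlg R) (toySubst R R) id
    ((kunneth_bijective R R R).1 (by
      refine (kunneth_toyCoop R _ _).trans ?_
      ext p
      simp))
    ((kunneth_bijective R R R).1 (by
      refine (kunneth_toyCoop R _ _).trans ?_
      ext p
      simp))
    (fun r => rfl)
    (fun B _ _ φ ψ => toySubst_coop R _ φ.hom ψ.hom (φ + ψ) rfl)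
    (fun B _ _ φ ψ => toySubst_coop R _ φ.hom ψ.hom (φ * ψ) rfl)
    (fun B _ _ r => rfl)
    (fun f g h => rfl)
    (fun g => rfl)
    (fun f => rfl)

theorem toyTW_comp (f g : R → R) : (toyTW R).comp f g = f ∘ g := rfl

end ToyMonoid

open Polynomial in
/-- The ideal `(x^q - x)` of `R[x]`. -/
noncomputable abbrev powSubIdeal (R : Type u) [CommRing R] (q : ℕ) : Ideal R[X] :=
  Ideal.span {(X : R[X]) ^ q - X}

end TallWraith

/-! Write q for the order of `R`. On every commutative `R`-algebra `B` the map b ↦ b^q is an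
`R`-algebra endomorphism, so the elements with b^q = b form a subalgebra. Homomorphisms out of
R[x]/(x^q - x) are exactly such elements, so this quotient represents a subfunctor of the identity
functor that is closed under all the operations. This is why the co-operations descend
(`isCoideal_powSubIdeal`, `powQuotCoAlg`).

The quotient is generated by a class fixed by Frobenius, hence Frobenius is the identity on all of
it (`powQuot_pow_natCard`). Any class can therefore be substituted for x, which makes composition
well defined on classes and gives the comonad structure (`powQuotTW`). Uniqueness holds because the
projection is surjective, so the compatibility conditions fix every structure map
(`TWMonoid.eq_of_surjective`).

The comparison with functions sends a polynomial to its values. It is injective because x^q - x is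
the product of all x - r, and surjective by Lagrange interpolation (`powQuotToFun_bijective`). Since
the class of x generates, each compatibility of homomorphisms out of the quotient is a check on that
one element. -/

namespace TallWraith

/-! ### Surjective and bijective morphisms of Tall–Wraith monoids -/

section Morphisms

variable {R : Type u} [CommRing R] {A : Type u} [CommRing A] [Algebra R A]
  {A' : Type u} [CommRing A'] [Algebra R A']

/-- The co-operations on the target of a surjective morphism of co-objects are determined by
those on the source. -/
theorem CoAlgObj.eq_of_surjective {c : CoAlgObj R A} {d d' : CoAlgObj R A'} {F : A →ₐ[R] A'}
    (hF : Function.Surjective F) (h : IsCoAlgHom c d F) (h' : IsCoAlgHom c d' F) : d = d' := by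
  -- A surjective homomorphism can be cancelled on the right, and each compatibility condition
  -- prescribes a co-operation of the target precomposed with `F`.
  have key {B : Type u} [CommRing B] [Algebra R B] {f g : A' →ₐ[R] B}
      (e : f.comp F = g.comp F) : f = g :=
    AlgHom.ext (hF.forall.2 fun a => DFunLike.congr_fun e a)
  exact CoAlgObj.ext (key (h.coadd_comm.symm.trans h'.coadd_comm))
    (key (h.comul_comm.symm.trans h'.comul_comm)) (key (h.coneg_comm.symm.trans h'.coneg_comm))
    (funext fun r => key ((h.coconst_comm r).symm.trans (h'.coconst_comm r)))

/-- The Tall-Wraith monoid structure on the target of a surjective morphism is determined by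
the one on the source. -/
theorem TWMonoid.eq_of_surjective {T : TWMonoid R A} {S S' : TWMonoid R A'} {F : A →ₐ[R] A'}
    (hF : Function.Surjective F) (h : IsTWHom T S F) (h' : IsTWHom T S' F) : S = S' := by
  have hc := CoAlgObj.eq_of_surjective hF h.toIsCoAlgHom h'.toIsCoAlgHom
  -- The types of the unit and the multiplication depend on the co-object, so the co-objects are
  -- identified before these can be compared.
  obtain ⟨c, ε, δ, _, _, _⟩ := S
  obtain ⟨c', ε', δ', _, _, _⟩ := S'
  obtain rfl : c = c' := hc
  have hε : ε = ε' := by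
    refine NatTrans.ext (funext fun B => CommAlgCat.hom_ext (AlgHom.ext fun φ => ?_))
    exact (h.counit_comm B (CoAlgObj.Points.hom (c := c) φ)).symm.trans
      (h'.counit_comm B (CoAlgObj.Points.hom (c := c) φ))
  have hδ : δ = δ' := by
    refine NatTrans.ext (funext fun B => CommAlgCat.hom_ext (AlgHom.ext fun φ => ?_))
    -- A point of the algebra of points is a function of two arguments in `A'`; by surjectivity both
    -- may be taken in the image of `F`, where `T` determines the value.
    refine CoAlgObj.Points.ext (c := c) (hF.forall.2 fun g => ?_)
    refine CoAlgObj.Points.ext (c := c) (hF.forall.2 fun f => ?_)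
    exact (h.comult_comm B (CoAlgObj.Points.hom (c := c) φ) g f).symm.trans
      (h'.comult_comm B (CoAlgObj.Points.hom (c := c) φ) g f)
  subst hε hδ
  rfl

/-- The inverse of a bijective morphism of co-objects is a morphism of co-objects. -/
theorem IsCoAlgHom.symm {c : CoAlgObj R A} {d : CoAlgObj R A'} {e : A ≃ₐ[R] A'}
    (h : IsCoAlgHom c d e.toAlgHom) : IsCoAlgHom d c e.symm.toAlgHom := by
  have he (a' : A') : e.toAlgHom (e.symm.toAlgHom a') = a' := e.apply_symm_apply a'
  have hmap (z : A ⊗[R] A) : Algebra.TensorProduct.map e.symm.toAlgHom e.symm.toAlgHom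
      (Algebra.TensorProduct.map e.toAlgHom e.toAlgHom z) = z := by
    induction z with
    | zero => simp
    | add a b ha hb => simp only [map_add, ha, hb]
    | tmul a b => simp
  refine ⟨AlgHom.ext fun a' => ?_, AlgHom.ext fun a' => ?_, AlgHom.ext fun a' => ?_,
    fun r => AlgHom.ext fun a' => ?_⟩
  · have := DFunLike.congr_fun h.coadd_comm (e.symm.toAlgHom a')
    simp only [AlgHom.comp_apply, he] at this ⊢
    rw [← this, hmap]
  · have := DFunLike.congr_fun h.comul_comm (e.symm.toAlgHom a')
    simp only [AlgHom.comp_apply, he] at this ⊢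
    rw [← this, hmap]
  · have := DFunLike.congr_fun h.coneg_comm (e.symm.toAlgHom a')
    simp only [AlgHom.comp_apply, he] at this ⊢
    rw [← this]
    exact e.symm_apply_apply _
  · have := DFunLike.congr_fun (h.coconst_comm r) (e.symm.toAlgHom a')
    simp only [AlgHom.comp_apply, he] at this ⊢
    exact this.symm

/-- The inverse of a bijective morphism of Tall-Wraith monoids is a morphism. -/
theorem IsTWHom.symm {T : TWMonoid R A} {S : TWMonoid R A'} {e : A ≃ₐ[R] A'}
    (h : IsTWHom T S e.toAlgHom) : IsTWHom S T e.symm.toAlgHom where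
  toIsCoAlgHom := h.toIsCoAlgHom.symm
  counit_comm B _ _ φ := by
    rw [← h.counit_comm, AlgHom.comp_assoc]
    congr 1
    exact AlgHom.ext fun a => congrArg φ (e.symm_apply_apply a)
  comult_comm B _ _ φ g f := by
    have hφ : (φ.comp e.symm.toAlgHom).comp e.toAlgHom = φ :=
      AlgHom.ext fun a => congrArg φ (e.symm_apply_apply a)
    have := h.comult_comm B (φ.comp e.symm.toAlgHom) (e.symm g) (e.symm f)
    rw [hφ] at this
    exact ((congrArg₂ _ (e.apply_symm_apply g) (e.apply_symm_apply f)).symm.trans this.symm)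

end Morphisms

/-! ### The algebra R[x]/(x^q - x) and its universal property -/

section PowQuotient

open Polynomial

variable (R : Type u) [Field R] (q : ℕ)

/-- The class of `x` in `R[x]/(x^q - x)`. -/
noncomputable def powQuotX : R[X] ⧸ powSubIdeal R q := Ideal.Quotient.mkₐ R (powSubIdeal R q) X

variable {R q}

/-- The class of x generates the quotient as an algebra. This reduces every diagram of co-operations
below to a computation on one element. -/
theorem powQuot_algHom_ext {B : Type u} [CommRing B] [Algebra R B]
    {f g : R[X] ⧸ powSubIdeal R q →ₐ[R] B} (h : f (powQuotX R q) = g (powQuotX R q)) : f = g :=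
  Ideal.Quotient.algHom_ext _ (Polynomial.algHom_ext h)

theorem powQuotX_pow : powQuotX R q ^ q = powQuotX R q := by
  rw [powQuotX, ← map_pow, ← sub_eq_zero, ← map_sub]
  exact Ideal.Quotient.eq_zero_iff_mem.2 (Ideal.mem_span_singleton_self _)

theorem aeval_eq_zero_of_mem_powSubIdeal {B : Type u} [CommRing B] [Algebra R B] {b : B}
    (hb : b ^ q = b) {f : R[X]} (hf : f ∈ powSubIdeal R q) : aeval b f = 0 := by
  obtain ⟨k, rfl⟩ := Ideal.mem_span_singleton.1 hf
  simp [hb]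

/-- The homomorphism from `R[x]/(x^q - x)` that sends the class of `x` to an element `b` with
`b ^ q = b`. -/
noncomputable def powLift {B : Type u} [CommRing B] [Algebra R B] (b : B) (hb : b ^ q = b) :
    R[X] ⧸ powSubIdeal R q →ₐ[R] B :=
  Ideal.Quotient.liftₐ _ (aeval b) fun _ => aeval_eq_zero_of_mem_powSubIdeal hb

@[simp] theorem powLift_powQuotX {B : Type u} [CommRing B] [Algebra R B] (b : B)
    (hb : b ^ q = b) : powLift b hb (powQuotX R q) = b :=
  aeval_X b

/-! ### Frobenius over the field with q elements -/

variable [Finite R] (hq : Nat.card R = q)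
include hq

/-- The `q`-th power map is additive on algebras over the field with `q` elements. -/
theorem add_pow_natCard {B : Type u} [CommRing B] [Algebra R B] (a b : B) :
    (a + b) ^ q = a ^ q + b ^ q := by
  cases nonempty_fintype R
  rw [← hq, Nat.card_eq_fintype_card]
  exact map_add (FiniteField.frobeniusAlgHom R B) a b

theorem neg_pow_natCard {B : Type u} [CommRing B] [Algebra R B] (a : B) :
    (-a) ^ q = -a ^ q := by
  cases nonempty_fintype R
  rw [← hq, Nat.card_eq_fintype_card]
  exact map_neg (FiniteField.frobeniusAlgHom R B) a

theorem pow_natCard (r : R) : r ^ q = r := by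
  cases nonempty_fintype R
  rw [← hq, Nat.card_eq_fintype_card, FiniteField.pow_card]

/-- Frobenius and the identity are both `R`-algebra endomorphisms, and they agree on the generator.
Hence every class, not only that of x, is an admissible value for `powLift`. -/
theorem powQuot_pow_natCard (a : R[X] ⧸ powSubIdeal R q) : a ^ q = a := by
  cases nonempty_fintype R
  have hq' := hq
  rw [Nat.card_eq_fintype_card] at hq'
  subst hq'
  exact DFunLike.congr_fun (powQuot_algHom_ext (g := AlgHom.id R _)
    (f := FiniteField.frobeniusAlgHom R _) powQuotX_pow) a

/-! ### The ideal (x^q - x) as a co-ideal compatible with composition -/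

theorem comp_mem_powSubIdeal {f : R[X]} (hf : f ∈ powSubIdeal R q) (g : R[X]) :
    f.comp g ∈ powSubIdeal R q := by
  rw [← Ideal.Quotient.eq_zero_iff_mem, ← Ideal.Quotient.mkₐ_eq_mk R, ← polyTW_comp]
  change Ideal.Quotient.mkₐ R (powSubIdeal R q) (aeval g f) = 0
  -- Modulo the ideal, f ∘ g is `f` evaluated at the class of `g`, which Frobenius fixes.
  rw [← aeval_algHom_apply]
  exact aeval_eq_zero_of_mem_powSubIdeal (powQuot_pow_natCard hq _) hf

/-- Every co-operation of R[x] is evaluation at some element b. It sends the ideal into J as soon as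
b^q - b lies in J, so one membership has to be verified for each co-operation. -/
theorem isCoideal_powSubIdeal : (polyCoAlg R).IsCoideal (powSubIdeal R q) := by
  have hspan {B : Type u} [CommRing B] [Algebra R B] (J : Ideal B) (b : B)
      (hb : b ^ q - b ∈ J) : ∀ f ∈ powSubIdeal R q, aeval b f ∈ J := by
    intro f hf
    obtain ⟨k, rfl⟩ := Ideal.mem_span_singleton.1 hf
    rw [map_mul]
    exact J.mul_mem_right _ (by simpa using hb)
  have hX : (X ^ q - X : R[X]) ∈ powSubIdeal R q := Ideal.mem_span_singleton_self _
  have hl := Ideal.mem_map_of_mem (Algebra.TensorProduct.includeLeft : R[X] →ₐ[R] R[X] ⊗[R] R[X]) hX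
  have hr := Ideal.mem_map_of_mem
    (Algebra.TensorProduct.includeRight : R[X] →ₐ[R] R[X] ⊗[R] R[X]) hX
  refine ⟨hspan _ _ ?_, hspan _ _ ?_, hspan _ _ ?_, fun r f hf =>
    aeval_eq_zero_of_mem_powSubIdeal (pow_natCard hq r) hf⟩
  -- By additivity of Frobenius, b^q - b for b = x ⊗ 1 + 1 ⊗ x is (x^q - x) ⊗ 1 + 1 ⊗ (x^q - x).
  · rw [add_pow_natCard hq]
    convert Submodule.add_mem_sup hl hr using 1
    simp [TensorProduct.sub_tmul, TensorProduct.tmul_sub]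
    ring
  -- The splitting used is x^q ⊗ x^q - x ⊗ x = (x^q - x) ⊗ x^q + x ⊗ (x^q - x).
  · convert Submodule.add_mem_sup (Ideal.mul_mem_right ((1 : R[X]) ⊗ₜ[R] (X ^ q : R[X])) _ hl)
      (Ideal.mul_mem_left _ ((X : R[X]) ⊗ₜ[R] (1 : R[X])) hr) using 1
    simp [TensorProduct.sub_tmul, TensorProduct.tmul_sub, sub_mul, mul_sub]
  · rw [neg_pow_natCard hq, ← neg_sub']
    exact neg_mem hX

theorem isCompCompatible_powSubIdeal : (polyTW R).IsCompCompatible (powSubIdeal R q) where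
  comp_sub_mem f g hg := by
    rw [polyTW_comp, polyTW_comp]
    refine Ideal.mem_of_dvd _ ?_ hg
    -- With its coefficients viewed in R[x], `f` takes the value f ∘ g at `g`; thus g - 0 divides f
    -- ∘ g - f ∘ 0.
    have := sub_dvd_eval_sub g 0 (f.map C)
    rwa [sub_zero, Polynomial.eval_map, Polynomial.eval_map] at this
  comp_mem f hf g := by
    rw [polyTW_comp]
    exact comp_mem_powSubIdeal hq hf g

/-! ### The Tall–Wraith monoid structure on the quotient -/

/-- The co-operations on `R[x]/(x^q - x)` that are induced by those on `R[x]`, for the field `R`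
with `q` elements. -/
noncomputable def powQuotCoAlg : CoAlgObj R (R[X] ⧸ powSubIdeal R q) where
  -- The formulas are those of R[x]. Each target must be fixed by Frobenius, which holds because
  -- Frobenius on a commutative `R`-algebra respects sums, products, negatives and constants.
  coadd := powLift (powQuotX R q ⊗ₜ[R] 1 + 1 ⊗ₜ[R] powQuotX R q) (by
    simp [add_pow_natCard hq, powQuotX_pow])
  comul := powLift (powQuotX R q ⊗ₜ[R] powQuotX R q) (by simp [powQuotX_pow])
  coneg := powLift (-powQuotX R q) (by rw [neg_pow_natCard hq, powQuotX_pow])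
  coconst r := powLift r (pow_natCard hq r)
  coadd_coassoc := by
    apply powQuot_algHom_ext
    simp [TensorProduct.add_tmul, TensorProduct.tmul_add, Algebra.TensorProduct.one_def, add_assoc]
  coadd_cocomm := by
    apply powQuot_algHom_ext
    simp [add_comm]
  coadd_counit := by
    apply powQuot_algHom_ext
    simp
  coadd_coneg := by
    apply powQuot_algHom_ext
    simp
  comul_coassoc := by
    apply powQuot_algHom_ext
    simp
  comul_cocomm := by
    apply powQuot_algHom_ext
    simp
  comul_counit := by
    apply powQuot_algHom_ext
    simp
  codistrib := by
    apply powQuot_algHom_ext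
    simp [TensorProduct.tmul_add, Algebra.TensorProduct.one_def]
  coconst_add r s := by
    apply powQuot_algHom_ext
    simp
  coconst_mul r s := by
    apply powQuot_algHom_ext
    simp

theorem powQuotCoAlg_coadd_X : (powQuotCoAlg hq).coadd (powQuotX R q) =
    powQuotX R q ⊗ₜ[R] 1 + 1 ⊗ₜ[R] powQuotX R q :=
  powLift_powQuotX _ (by simp [add_pow_natCard hq, powQuotX_pow])

theorem powQuotCoAlg_comul_X : (powQuotCoAlg hq).comul (powQuotX R q) =
    powQuotX R q ⊗ₜ[R] powQuotX R q :=
  powLift_powQuotX _ (by simp [powQuotX_pow])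

theorem powQuotCoAlg_coneg_X : (powQuotCoAlg hq).coneg (powQuotX R q) = -powQuotX R q :=
  powLift_powQuotX _ (by rw [neg_pow_natCard hq, powQuotX_pow])

theorem powQuotCoAlg_coconst_X (r : R) : (powQuotCoAlg hq).coconst r (powQuotX R q) = r :=
  powLift_powQuotX _ (pow_natCard hq r)

/-- The points of `R[x]/(x^q - x)` in `B`, as elements of `B`. -/
noncomputable def powQuotPt (B : Type u) [CommRing B] [Algebra R B] :
    (powQuotCoAlg hq).Points B →ₐ[R] B where
  toFun φ := φ.hom (powQuotX R q)
  map_one' := by simp [CoAlgObj.one_hom, powQuotCoAlg_coconst_X]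
  map_mul' φ ψ := by simp [CoAlgObj.mul_hom, powQuotCoAlg_comul_X]
  map_zero' := by simp [CoAlgObj.zero_hom, powQuotCoAlg_coconst_X]
  map_add' φ ψ := by simp [CoAlgObj.add_hom, powQuotCoAlg_coadd_X]
  commutes' r := by
    simp [CoAlgObj.algebraMap_points, CoAlgObj.constPoint_hom, powQuotCoAlg_coconst_X,
      Algebra.ofId_apply]

/-- This realises the points in `B` as a subalgebra of `B`, so identities between points can be
verified in `B`. -/
theorem powQuotPt_injective (B : Type u) [CommRing B] [Algebra R B] :
    Function.Injective (powQuotPt hq B) := fun _ _ h => powQuot_algHom_ext h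

theorem powQuotPt_point_powLift (g : R[X] ⧸ powSubIdeal R q) :
    powQuotPt hq _ ((powQuotCoAlg hq).point (powLift g (powQuot_pow_natCard hq g))) = g :=
  powLift_powQuotX g (powQuot_pow_natCard hq g)

/-- Substitution `g ↦ (f ↦ f ∘ g)` on classes of polynomials. -/
noncomputable def powQuotSubst :
    R[X] ⧸ powSubIdeal R q →ₐ[R] (powQuotCoAlg hq).Points (R[X] ⧸ powSubIdeal R q) where
  toFun g := (powQuotCoAlg hq).point (powLift g (powQuot_pow_natCard hq g))
  map_one' := powQuotPt_injective hq _ (by rw [powQuotPt_point_powLift, map_one])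
  map_mul' g h := powQuotPt_injective hq _ (by
    rw [map_mul, powQuotPt_point_powLift, powQuotPt_point_powLift, powQuotPt_point_powLift])
  map_zero' := powQuotPt_injective hq _ (by rw [powQuotPt_point_powLift, map_zero])
  map_add' g h := powQuotPt_injective hq _ (by
    rw [map_add, powQuotPt_point_powLift, powQuotPt_point_powLift, powQuotPt_point_powLift])
  commutes' r := powQuotPt_injective hq _ (by rw [powQuotPt_point_powLift, AlgHom.commutes])

theorem powQuotSubst_hom_X (g : R[X] ⧸ powSubIdeal R q) :
    (powQuotSubst hq g).hom (powQuotX R q) = g :=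
  powLift_powQuotX g (powQuot_pow_natCard hq g)

/-- Applying `powQuotPt` twice embeds the points of the algebra of points into `B`. Seen there, the
multiplication of the monoid changes nothing, so its compatibility with the operations reduces to
that of `powQuotPt`. -/
theorem powQuotPt_powQuotPt_subst {B : Type u} [CommRing B] [Algebra R B]
    (χ : (powQuotCoAlg hq).Points B) :
    powQuotPt hq B (powQuotPt hq _ ((powQuotCoAlg hq).point
      (((powQuotCoAlg hq).mapPoints χ.hom).comp (powQuotSubst hq)))) = powQuotPt hq B χ :=
  congrArg χ.hom (powQuotSubst_hom_X hq (powQuotX R q))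

/-- The Tall-Wraith monoid `R[x]/(x^q - x)` over the field `R` with `q` elements. -/
noncomputable def powQuotTW : TWMonoid R (R[X] ⧸ powSubIdeal R q) :=
  TWMonoid.ofComp (powQuotCoAlg hq) (powQuotSubst hq) (powQuotX R q)
    (powQuotCoAlg_coadd_X hq)
    (powQuotCoAlg_comul_X hq)
    (powQuotCoAlg_coconst_X hq)
    (fun B _ _ φ ψ => by
      apply powQuotPt_injective
      apply powQuotPt_injective
      rw [map_add, map_add]
      simp only [powQuotPt_powQuotPt_subst]
      rw [map_add])
    (fun B _ _ φ ψ => by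
      apply powQuotPt_injective
      apply powQuotPt_injective
      rw [map_mul, map_mul]
      simp only [powQuotPt_powQuotPt_subst]
      rw [map_mul])
    (fun B _ _ r => by
      apply powQuotPt_injective
      apply powQuotPt_injective
      rw [← CoAlgObj.algebraMap_points, ← CoAlgObj.algebraMap_points, AlgHom.commutes,
        AlgHom.commutes, powQuotPt_powQuotPt_subst, AlgHom.commutes])
    -- For fixed `g` and `h`, both sides of associativity are algebra homomorphisms in `f`, and at
    -- the class of x both equal `g` with `h` substituted.
    (fun f g h => DFunLike.congr_fun (powQuot_algHom_ext
      (f := (powQuotSubst hq h).hom.comp (powQuotSubst hq g).hom)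
      (g := (powQuotSubst hq ((powQuotSubst hq h).hom g)).hom)
      (by rw [AlgHom.comp_apply, powQuotSubst_hom_X, powQuotSubst_hom_X])) f)
    (powQuotSubst_hom_X hq)
    (fun f => DFunLike.congr_fun (powQuot_algHom_ext
      (f := (powQuotSubst hq (powQuotX R q)).hom) (g := AlgHom.id R _)
      (powQuotSubst_hom_X hq _)) f)

/-! ### The projection from R[x] as a morphism -/

theorem isTWHom_mk : IsTWHom (polyTW R) (powQuotTW hq)
    (Ideal.Quotient.mkₐ R (powSubIdeal R q)) where
  coadd_comm := Polynomial.algHom_ext (by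
    refine Eq.trans ?_ (powQuotCoAlg_coadd_X hq).symm
    rw [AlgHom.comp_apply]
    refine (congrArg _ (aeval_X (R := R) _)).trans ?_
    simp [powQuotX])
  comul_comm := Polynomial.algHom_ext (by
    refine Eq.trans ?_ (powQuotCoAlg_comul_X hq).symm
    rw [AlgHom.comp_apply]
    refine (congrArg _ (aeval_X (R := R) _)).trans ?_
    simp [powQuotX])
  coneg_comm := Polynomial.algHom_ext (by
    refine Eq.trans ?_ (powQuotCoAlg_coneg_X hq).symm
    rw [AlgHom.comp_apply]
    refine (congrArg _ (aeval_X (R := R) _)).trans ?_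
    simp [powQuotX])
  coconst_comm r := Polynomial.algHom_ext
    ((aeval_X r).trans (powQuotCoAlg_coconst_X hq r).symm)
  counit_comm B _ _ φ := rfl
  comult_comm B _ _ φ g f := by
    -- Both multiplications at `φ` are `φ` applied to a composite in the quotient, so `φ` can be
    -- dropped. For fixed `g` both composites are homomorphisms in `f` that send x to the class of
    -- `g`.
    refine congrArg φ (DFunLike.congr_fun (Polynomial.algHom_ext
      (f := (Ideal.Quotient.mkₐ R (powSubIdeal R q)).comp (aeval g))
      (g := (powQuotSubst hq (Ideal.Quotient.mkₐ R _ g)).hom.comp (Ideal.Quotient.mkₐ R _)) ?_) f)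
    exact (congrArg _ (aeval_X g)).trans (powQuotSubst_hom_X hq _).symm

/-! ### Comparison with the monoid of all functions -/

/-- The homomorphism from `R[x]/(x^q - x)` to functions on the field `R` with `q` elements that
sends a class to its polynomial function. -/
noncomputable def powQuotToFun : R[X] ⧸ powSubIdeal R q →ₐ[R] (R → R) :=
  powLift id (funext fun r => pow_natCard hq r)

theorem powQuotToFun_X : powQuotToFun hq (powQuotX R q) = id := powLift_powQuotX _ _

theorem powQuotToFun_mk (f : R[X]) (r : R) :
    powQuotToFun hq (Ideal.Quotient.mkₐ R _ f) r = f.eval r := by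
  have := DFunLike.congr_fun (Polynomial.algHom_ext
    (f := (Pi.evalAlgHom R (fun _ : R => R) r).comp
      ((powQuotToFun hq).comp (Ideal.Quotient.mkₐ R _))) (g := aeval r)
    ((congrFun (powQuotToFun_X hq) r).trans (aeval_X r).symm)) f
  rwa [coe_aeval_eq_eval] at this

/-- A polynomial vanishing on all of `R` is divisible by each x - r. These factors are pairwise
coprime, so their product x^q - x divides it too. Surjectivity is Lagrange interpolation with every
element of `R` as a node. -/
theorem powQuotToFun_bijective : Function.Bijective (powQuotToFun hq) := by
  classical
  cases nonempty_fintype R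
  constructor
  · rw [injective_iff_map_eq_zero]
    refine (Ideal.Quotient.mkₐ_surjective R _).forall.2 fun f hf => ?_
    refine Ideal.Quotient.eq_zero_iff_mem.2 (Ideal.mem_span_singleton.2 ?_)
    have hprod : (X ^ q - X : R[X]) = ∏ r : R, (X - C r) := by
      rw [← hq, Nat.card_eq_fintype_card]
      -- A monic polynomial with as many roots as its degree is the product of its linear factors;
      -- here the roots are the q elements of `R`, each once.
      have h := prod_multiset_X_sub_C_of_monic_of_roots_card_eq
        (p := (X ^ Fintype.card R - X : R[X]))
        (monic_X_pow_sub (by rw [degree_X]; exact_mod_cast Fintype.one_lt_card))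
        (by
          rw [FiniteField.roots_X_pow_card_sub_X,
            FiniteField.X_pow_card_sub_X_natDegree_eq _ Fintype.one_lt_card]
          rfl)
      rw [FiniteField.roots_X_pow_card_sub_X] at h
      exact h.symm
    rw [hprod]
    refine Finset.prod_dvd_of_coprime
      (fun a _ b _ hab => pairwise_coprime_X_sub_C Function.injective_id hab) fun r _ => ?_
    rw [dvd_iff_isRoot, IsRoot, ← powQuotToFun_mk hq, hf, Pi.zero_apply]
  · intro F
    refine ⟨Ideal.Quotient.mkₐ R _ (Lagrange.interpolate Finset.univ id F), funext fun r => ?_⟩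
    rw [powQuotToFun_mk]
    exact Lagrange.eval_interpolate_at_node F Function.injective_id.injOn (Finset.mem_univ r)

theorem isTWHom_powQuotToFun : IsTWHom (powQuotTW hq) (toyTW R) (powQuotToFun hq) where
  -- Through the injective Künneth map, both sides at the class of x become the addition function on
  -- R × R.
  coadd_comm := powQuot_algHom_ext ((kunneth_bijective R R R).1 (by
    rw [AlgHom.comp_apply, AlgHom.comp_apply, powQuotToFun_X]
    refine Eq.trans ?_ (kunneth_toyCoop R _ id).symm
    refine (congrArg (fun z => kunneth R R R (Algebra.TensorProduct.map _ _ z))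
      (powQuotCoAlg_coadd_X hq)).trans ?_
    funext p
    simp [powQuotToFun_X]))
  comul_comm := powQuot_algHom_ext ((kunneth_bijective R R R).1 (by
    rw [AlgHom.comp_apply, AlgHom.comp_apply, powQuotToFun_X]
    refine Eq.trans ?_ (kunneth_toyCoop R _ id).symm
    refine (congrArg (fun z => kunneth R R R (Algebra.TensorProduct.map _ _ z))
      (powQuotCoAlg_comul_X hq)).trans ?_
    funext p
    simp [powQuotToFun_X]))
  coneg_comm := powQuot_algHom_ext (by
    rw [AlgHom.comp_apply, AlgHom.comp_apply, powQuotToFun_X]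
    refine (congrArg _ (powQuotCoAlg_coneg_X hq)).trans ?_
    rw [map_neg, powQuotToFun_X]
    rfl)
  coconst_comm r := powQuot_algHom_ext ((powQuotCoAlg_coconst_X hq r).trans
    (congrFun (powQuotToFun_X hq) r).symm)
  counit_comm B _ _ φ := congrArg φ (powQuotToFun_X hq)
  comult_comm B _ _ φ g f := by
    -- For fixed `g`, substituting before or after passing to functions gives two homomorphisms in
    -- `f`; both send the class of x to the function of `g`.
    refine congrArg φ (DFunLike.congr_fun (powQuot_algHom_ext
      (f := (powQuotToFun hq).comp (powQuotSubst hq g).hom)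
      (g := (pullback R (powQuotToFun hq g)).comp (powQuotToFun hq)) ?_) f)
    rw [AlgHom.comp_apply, AlgHom.comp_apply, powQuotSubst_hom_X, powQuotToFun_X]
    rfl

end PowQuotient

end TallWraith

theorem mainTheorem12 (R : Type u) [Field R] [Finite R] (p n : ℕ) [CharP R p]
    (hcard : Nat.card R = p ^ n) :
    (TallWraith.polyCoAlg R).IsCoideal (TallWraith.powSubIdeal R (p ^ n)) ∧
    (TallWraith.polyTW R).IsCompCompatible (TallWraith.powSubIdeal R (p ^ n)) ∧
    ∃ Q : TallWraith.TWMonoid R (R[X] ⧸ TallWraith.powSubIdeal R (p ^ n)),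
      TallWraith.IsTWHom (TallWraith.polyTW R) Q
        (Ideal.Quotient.mkₐ R (TallWraith.powSubIdeal R (p ^ n))) ∧
      (∀ Q' : TallWraith.TWMonoid R (R[X] ⧸ TallWraith.powSubIdeal R (p ^ n)),
        TallWraith.IsTWHom (TallWraith.polyTW R) Q'
          (Ideal.Quotient.mkₐ R (TallWraith.powSubIdeal R (p ^ n))) → Q' = Q) ∧
      ∃ η : (R[X] ⧸ TallWraith.powSubIdeal R (p ^ n)) ≃ₐ[R] (R → R),
        η (Ideal.Quotient.mkₐ R (TallWraith.powSubIdeal R (p ^ n)) Polynomial.X) = id ∧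
        TallWraith.IsTWHom Q (TallWraith.toyTW R) η.toAlgHom ∧
        TallWraith.IsTWHom (TallWraith.toyTW R) Q η.symm.toAlgHom := by
  open TallWraith in
  exact ⟨isCoideal_powSubIdeal hcard, isCompCompatible_powSubIdeal hcard, powQuotTW hcard,
    isTWHom_mk hcard,
    fun Q' hQ' => TWMonoid.eq_of_surjective (Ideal.Quotient.mkₐ_surjective R _) hQ'
      (isTWHom_mk hcard),
    AlgEquiv.ofBijective (powQuotToFun hcard) (powQuotToFun_bijective hcard),
    powQuotToFun_X hcard, isTWHom_powQuotToFun hcard,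
    IsTWHom.symm (e := AlgEquiv.ofBijective (powQuotToFun hcard) (powQuotToFun_bijective hcard))
      (isTWHom_powQuotToFun hcard)⟩
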